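/- Let $\Bbbk$ be a commutative ring. A pre-Lie algebra over $\Bbbk$ is a $\Bbbk$-module $L$ with a bilinear product $\circ$ such that $$a\circ(b\circ c)-(a\circ b)\circ c = a\circ(c\circ b)-(a\circ c)\circ b\qquad\text{for all } a,b,c\in L,$$ and a morphism of pre-Lie algebras is a $\Bbbk$-linear map that preserves the products. Let $X$ be a set. An $X$-colored rooted tree is a finite poset $T$ with a minimum (its root) in which any two elements having a common upper bound are comparable, together with a map from $T$ to $X$ giving the color of each element (vertex); such trees are considered up to color-preserving isomorphism of posets. For two such trees $T_1$, $T_2$ and a vertex $v$ of $T_1$, let $T_1\circ_v T_2$ be the $X$-colored rooted tree whose set of vertices is the disjoint union of those of $T_1$ and $T_2$, with the induced colors and with the order generated by the orders of $T_1$ and $T_2$ and by $v<w$ for all vertices $w$ of $T_2$. Let $\mathcal{PL}(X)$ be the free $\Bbbk$-module with basis the set of $X$-colored rooted trees, with the bilinear product determined by $$T_1\circ T_2=\sum_{v\in T_1}T_1\circ_v T_2 .$$ **Proposition 3.1.** $\mathcal{PL}(X)$ is the free pre-Lie algebra generated by $X$. That is, $(\mathcal{PL}(X),\circ)$ is a pre-Lie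 algebra, and for every pre-Lie algebra $L$ over $\Bbbk$ and every map $f\colon X\to L$ there is a unique morphism of pre-Lie algebras $\varphi\colon\mathcal{PL}(X)\to L$ such that $\varphi(\bullet_x)=f(x)$ for all $x\in X$, where $\bullet_x$ denotes the tree with a single vertex, colored by $x$. -/

import Mathlib

universe u w

/-- An `X`-colored rooted tree: a finite poset with a minimum (the root) and no critical pair
(any two elements below a common element are comparable), with a map from its vertices to the set
of colors `X`. A finite poset has an isomorphic copy in `Type`, so carriers in `Type` suffice. -/
structure ColoredRootedTree (X : Type u) where
  /-- The set of vertices. -/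
  carrier : Type
  [fintype : Fintype carrier]
  [partialOrder : PartialOrder carrier]
  /-- The root, which is the minimum of the poset. -/
  root : carrier
  root_le : ∀ v : carrier, root ≤ v
  comparable : ∀ x y z : carrier, y ≤ x → z ≤ x → y ≤ z ∨ z ≤ y
  /-- The color of a vertex. -/
  color : carrier → X

namespace ColoredRootedTree

variable {X : Type u}

attribute [instance] ColoredRootedTree.fintype ColoredRootedTree.partialOrder

/-- An isomorphism of colored rooted trees: an isomorphism of posets that preserves the colors.
(It automatically preserves the root.) -/
structure Iso (S T : ColoredRootedTree X) where
  /-- The underlying isomorphism of posets. -/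
  toOrderIso : S.carrier ≃o T.carrier
  color_apply : ∀ v, T.color (toOrderIso v) = S.color v

/-- Trees are considered up to isomorphism. -/
instance isoSetoid (X : Type u) : Setoid (ColoredRootedTree X) where
  r S T := Nonempty (Iso S T)
  iseqv :=
    { refl := fun S => ⟨⟨OrderIso.refl _, fun _ => rfl⟩⟩
      symm := by
        rintro S T ⟨e⟩
        refine ⟨⟨e.toOrderIso.symm, fun v => ?_⟩⟩
        have h := e.color_apply (e.toOrderIso.symm v)
        rw [OrderIso.apply_symm_apply] at h
        exact h.symm
      trans := by
        rintro S T U ⟨e⟩ ⟨f⟩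
        refine ⟨⟨e.toOrderIso.trans f.toOrderIso, fun v => ?_⟩⟩
        rw [OrderIso.trans_apply, f.color_apply, e.color_apply] }

/-- The tree with one vertex, of color `x`. -/
def vertex (x : X) : ColoredRootedTree X where
  carrier := Unit
  root := ()
  root_le _ := le_rfl
  comparable _ _ _ _ _ := Or.inl le_rfl
  color _ := x

/-- The order on the disjoint union of the vertices of `S` and `T` that is induced by the orders of
`S` and `T` and by `v < w` for all `w` in `T`. -/
def graftLE (S : ColoredRootedTree X) (v : S.carrier) (T : ColoredRootedTree X) :
    S.carrier ⊕ T.carrier → S.carrier ⊕ T.carrier → Prop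
  | .inl a, .inl b => a ≤ b
  | .inl a, .inr _ => a ≤ v
  | .inr _, .inl _ => False
  | .inr a, .inr b => a ≤ b

/-- The grafting `S ∘_v T` of the tree `T` on the vertex `v` of the tree `S`. -/
def graft (S : ColoredRootedTree X) (v : S.carrier) (T : ColoredRootedTree X) :
    ColoredRootedTree X where
  carrier := S.carrier ⊕ T.carrier
  partialOrder :=
    { le := graftLE S v T
      lt := fun a b => graftLE S v T a b ∧ ¬ graftLE S v T b a
      lt_iff_le_not_ge := fun _ _ => Iff.rfl
      le_refl := by
        rintro (a | a)
        · exact le_refl a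
        · exact le_refl a
      le_trans := by
        rintro (a | a) (b | b) (c | c) hab hbc
        · exact le_trans (α := S.carrier) hab hbc
        · exact le_trans (α := S.carrier) hab hbc
        · exact hbc.elim
        · exact hab
        · exact hab.elim
        · exact hab.elim
        · exact hbc.elim
        · exact le_trans (α := T.carrier) hab hbc
      le_antisymm := by
        rintro (a | a) (b | b) hab hba
        · exact congrArg Sum.inl (le_antisymm (α := S.carrier) hab hba)
        · exact hba.elim
        · exact hab.elim
        · exact congrArg Sum.inr (le_antisymm (α := T.carrier) hab hba) }
  root := Sum.inl S.root
  root_le := by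
    rintro (a | a)
    · exact S.root_le a
    · exact S.root_le v
  comparable := by
    rintro (x | x) (y | y) (z | z) hy hz
    · exact S.comparable x y z hy hz
    · exact hz.elim
    · exact hy.elim
    · exact hy.elim
    · exact S.comparable v y z hy hz
    · exact Or.inl hy
    · exact Or.inr hz
    · exact T.comparable x y z hy hz
  color := Sum.elim S.color T.color

/-- Grafting is compatible with isomorphisms. -/
def graftIso {S S' T T' : ColoredRootedTree X} (e : Iso S S') (f : Iso T T') (v : S.carrier) :
    Iso (graft S v T) (graft S' (e.toOrderIso v) T') where
  toOrderIso :=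
    { toEquiv := Equiv.sumCongr e.toOrderIso.toEquiv f.toOrderIso.toEquiv
      map_rel_iff' := by
        rintro (a | a) (b | b)
        · exact e.toOrderIso.le_iff_le
        · exact e.toOrderIso.le_iff_le
        · exact Iff.rfl
        · exact f.toOrderIso.le_iff_le }
  color_apply := by
    rintro (a | a)
    · exact e.color_apply a
    · exact f.color_apply a

end ColoredRootedTree

/-- The set of isomorphism classes of `X`-colored rooted trees. -/
abbrev ColoredRootedTreeClass (X : Type u) := Quotient (ColoredRootedTree.isoSetoid X)

/-- The free `k`-module on the set of (isomorphism classes of) `X`-colored rooted trees. -/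
def PL (k : Type w) [CommRing k] (X : Type u) := ColoredRootedTreeClass X →₀ k

namespace PL

variable (k : Type w) [CommRing k] {X : Type u}

noncomputable instance : AddCommGroup (PL k X) :=
  inferInstanceAs (AddCommGroup (ColoredRootedTreeClass X →₀ k))

noncomputable instance : Module k (PL k X) :=
  inferInstanceAs (Module k (ColoredRootedTreeClass X →₀ k))

/-- The basis of `PL k X` given by the trees. -/
noncomputable def basis (X : Type u) : Module.Basis (ColoredRootedTreeClass X) k (PL k X) :=
  Module.Basis.ofRepr (LinearEquiv.refl k (ColoredRootedTreeClass X →₀ k))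

/-- The basis element of `PL k X` given by a tree. -/
noncomputable def ofTree (T : ColoredRootedTree X) : PL k X := basis k X (Quotient.mk _ T)

/-- The sum `∑ v, S ∘_v T` over the vertices `v` of `S`. -/
noncomputable def graftSum (S T : ColoredRootedTree X) : PL k X :=
  ∑ v : S.carrier, ofTree k (S.graft v T)

theorem graftSum_congr {S T S' T' : ColoredRootedTree X} (hS : S ≈ S') (hT : T ≈ T') :
    graftSum k S T = graftSum k S' T' := by
  obtain ⟨e⟩ := hS
  obtain ⟨f⟩ := hT
  refine Fintype.sum_equiv e.toOrderIso.toEquiv _ _ fun v => ?_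
  exact congrArg (basis k X) (Quotient.sound ⟨ColoredRootedTree.graftIso e f v⟩)

/-- The product of two isomorphism classes of trees. -/
noncomputable def graftSumClass (s t : ColoredRootedTreeClass X) : PL k X :=
  Quotient.lift₂ (graftSum k) (fun _ _ _ _ => graftSum_congr k) s t

/-- The grafting product, as a bilinear map: the bilinear extension of
`S ∘ T = ∑ v, S ∘_v T`. -/
noncomputable def mulBilin (X : Type u) : PL k X →ₗ[k] PL k X →ₗ[k] PL k X :=
  (basis k X).constr k fun s => (basis k X).constr k fun t => graftSumClass k s t

/-- `PL k X` with the grafting product, written `*`. -/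
noncomputable instance : NonUnitalNonAssocRing (PL k X) where
  mul a b := mulBilin k X a b
  left_distrib a b c := map_add (mulBilin k X a) b c
  right_distrib a b c := LinearMap.map_add₂ (mulBilin k X) a b c
  zero_mul a := LinearMap.map_zero₂ (mulBilin k X) a
  mul_zero a := map_zero (mulBilin k X a)

instance : IsScalarTower k (PL k X) (PL k X) where
  smul_assoc r a b := LinearMap.map_smul₂ (mulBilin k X) r a b

instance : SMulCommClass k (PL k X) (PL k X) where
  smul_comm r a b := (map_smul (mulBilin k X a) r b).symm

/-- On trees the product is the sum of all graftings. -/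
theorem ofTree_mul_ofTree (S T : ColoredRootedTree X) :
    ofTree k S * ofTree k T = ∑ v : S.carrier, ofTree k (S.graft v T) := by
  change mulBilin k X (basis k X _) (basis k X _) = graftSum k S T
  rw [mulBilin, Module.Basis.constr_basis, Module.Basis.constr_basis]
  rfl

end PL

-- The pre-Lie identity holds on trees because the associator of S, T, U counts the ways of grafting
-- T and U independently on two, possibly equal, vertices of S, which is symmetric in T and U
-- (`associator_ofTree`). Existence: in a pre-Lie algebra, the recursion in `listBrace` gives
-- multilinear braces, and the pre-Lie identity makes them symmetric (`listBrace_swap`). Send a tree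
-- to the brace of its root color with the values of the branches at the children of the root.
-- Grafting T on the root inserts one more argument into this brace; by the recursion this is the
-- product by the value of T, minus the terms where that product acts inside one argument. The
-- graftings on the other vertices supply exactly those terms (`sum_branchValue_graft`). Uniqueness:
-- a tree with more than one vertex is a grafting of some U on the root of some S, hence S ∘ U minus
-- graftings of U higher up. Those have more order relations, so induction applies
-- (`graft_induction`).

universe v

/-! ### Symmetric braces in a pre-Lie ring -/

section

open Function

/-- The symmetric brace `x{y i : i ∈ l}` of a right pre-Lie ring, defined by
`x{y, y₁, …, yₙ} = x{y₁, …, yₙ} * y - ∑ j, x{y₁, …, yⱼ * y, …, yₙ}`. -/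
def listBrace {ι L : Type*} [DecidableEq ι] [NonUnitalNonAssocRing L] (x : L) :
    List ι → (ι → L) → L
  | [], _ => x
  | i :: l, y => listBrace x l y * y i -
      ∑ j ∈ l.toFinset, listBrace x l (update y j (y j * y i))

section ListBrace

variable {ι L : Type*} [DecidableEq ι]

theorem listBrace_congr [NonUnitalNonAssocRing L] (x : L) (l : List ι) {y z : ι → L}
    (h : ∀ i ∈ l, y i = z i) : listBrace x l y = listBrace x l z := by
  induction l generalizing y z with
  | nil => rfl
  | cons i l ih =>
    have hi : y i = z i := h i (by simp)
    have hl : ∀ j ∈ l, y j = z j := fun j hj => h j (by simp [hj])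
    simp only [listBrace]
    rw [ih hl, hi]
    congr 1
    refine Finset.sum_congr rfl fun j hj => ih fun m hm => ?_
    rw [hl j (by simpa using hj)]
    by_cases hmj : m = j
    · subst hmj; simp
    · simp [hmj, hl m hm]

theorem listBrace_update_of_notMem [NonUnitalNonAssocRing L] (x : L) {l : List ι} (y : ι → L)
    {i : ι} (hi : i ∉ l) (u : L) : listBrace x l (update y i u) = listBrace x l y :=
  listBrace_congr x l fun _ hj => update_of_ne (ne_of_mem_of_not_mem hj hi) _ _

/-- Distributivity pushed through the recursion. Without repetitions, the updated slot feeds a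
single argument; a repeated index would break additivity. -/
theorem listBrace_update_add [NonUnitalNonAssocRing L] (x : L) {l : List ι} (hl : l.Nodup)
    (y : ι → L) {m : ι} (hm : m ∈ l) (u v : L) :
    listBrace x l (update y m (u + v)) =
      listBrace x l (update y m u) + listBrace x l (update y m v) := by
  induction l generalizing y m u v with
  | nil => simp at hm
  | cons i l ih =>
    obtain ⟨hil, hnd⟩ := List.nodup_cons.1 hl
    simp only [listBrace]
    by_cases hmi : m = i
    · subst hmi
      have key : ∀ w : L, ∑ j ∈ l.toFinset, listBrace x l (update (update y m w) j
          (update y m w j * w)) = ∑ j ∈ l.toFinset, listBrace x l (update y j (y j * w)) := by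
        intro w
        refine Finset.sum_congr rfl fun j hj => ?_
        have hjm : j ≠ m := fun h => hil (by simpa [h] using hj)
        rw [update_of_ne hjm, update_comm hjm.symm, listBrace_update_of_notMem x _ hil]
      simp only [update_self, key, listBrace_update_of_notMem x _ hil]
      simp only [mul_add]
      rw [Finset.sum_congr rfl fun j hj => ih hnd y (List.mem_toFinset.1 hj) _ _,
        Finset.sum_add_distrib]
      abel
    · have hml : m ∈ l := by simpa [hmi] using hm
      have key : ∑ j ∈ l.toFinset, listBrace x l (update (update y m (u + v)) j
            (update y m (u + v) j * y i)) =
          ∑ j ∈ l.toFinset, (listBrace x l (update (update y m u) j (update y m u j * y i)) +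
            listBrace x l (update (update y m v) j (update y m v j * y i))) := by
        refine Finset.sum_congr rfl fun j hj => ?_
        by_cases hjm : j = m
        · subst hjm
          simp only [update_self, update_idem, add_mul]
          exact ih hnd y hml _ _
        · simp only [update_of_ne hjm]
          rw [update_comm (Ne.symm hjm), ih hnd _ hml, update_comm hjm, update_comm hjm]
      simp only [update_of_ne (Ne.symm hmi)]
      rw [key, ih hnd y hml, add_mul, Finset.sum_add_distrib]
      abel

/-- After unfolding twice, the asymmetry in `i` and `j` lies in associators: that of the inner brace
with `y j`, `y i`, and, inside each slot `m`, that of `y m` with them. The pre-Lie identity removes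
both kinds. -/
theorem listBrace_swap [RightPreLieRing L] (x : L) {l : List ι} {i j : ι}
    (hl : (i :: j :: l).Nodup) (y : ι → L) :
    listBrace x (i :: j :: l) y = listBrace x (j :: i :: l) y := by
  have expand : ∀ {i j : ι}, (i :: j :: l).Nodup → listBrace x (i :: j :: l) y =
      (listBrace x l y * y j) * y i - listBrace x l y * (y j * y i)
      - (∑ m ∈ l.toFinset, listBrace x l (update y m (y m * y j)) * y i
        + ∑ m ∈ l.toFinset, listBrace x l (update y m (y m * y i)) * y j)
      + ∑ m ∈ l.toFinset, listBrace x l (update y m (y m * (y j * y i)))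
      + ∑ m ∈ l.toFinset, ∑ n ∈ l.toFinset, listBrace x l
        (update (update y m (y m * y i)) n (update y m (y m * y i) n * y j)) := by
    intro i j hl
    obtain ⟨hi, hl⟩ := List.nodup_cons.1 hl
    obtain ⟨hj, hl⟩ := List.nodup_cons.1 hl
    have hjl : j ∉ l.toFinset := by simpa using hj
    simp only [listBrace, List.toFinset_cons, Finset.sum_insert hjl, update_self,
      listBrace_update_of_notMem x _ hj, Finset.sum_sub_distrib, sub_mul, Finset.sum_mul]
    have e1 : ∑ m ∈ l.toFinset, listBrace x l (update (update y j (y j * y i)) m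
          (update y j (y j * y i) m * (y j * y i))) =
        ∑ m ∈ l.toFinset, listBrace x l (update y m (y m * (y j * y i))) := by
      refine Finset.sum_congr rfl fun m hm => ?_
      have hmj : m ≠ j := fun h => hjl (h ▸ hm)
      rw [update_of_ne hmj, update_comm hmj.symm, listBrace_update_of_notMem x _ hj]
    have e2 : ∀ m ∈ l.toFinset, update y m (y m * y i) j = y j := fun m hm =>
      update_of_ne (ne_of_mem_of_not_mem hm hjl).symm _ _
    have e3 : ∑ m ∈ l.toFinset, listBrace x l (update y m (y m * y i)) *
          update y m (y m * y i) j =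
        ∑ m ∈ l.toFinset, listBrace x l (update y m (y m * y i)) * y j :=
      Finset.sum_congr rfl fun m hm => by rw [e2 m hm]
    have e4 : ∑ m ∈ l.toFinset, ∑ n ∈ l.toFinset, listBrace x l
          (update (update y m (y m * y i)) n
            (update y m (y m * y i) n * update y m (y m * y i) j)) =
        ∑ m ∈ l.toFinset, ∑ n ∈ l.toFinset, listBrace x l
          (update (update y m (y m * y i)) n (update y m (y m * y i) n * y j)) :=
      Finset.sum_congr rfl fun m hm => by rw [e2 m hm]
    rw [e1, e3, e4]
    abel
  have hnd : l.Nodup := (List.nodup_cons.1 (List.nodup_cons.1 hl).2).2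
  have assoc : ∀ a b c : L, (a * b) * c - a * (b * c) = (a * c) * b - a * (c * b) :=
    fun a b c => RightPreLieRing.assoc_symm' a b c
  rw [expand hl, expand ((List.Perm.swap j i l).nodup_iff.1 hl)]
  have main : ∑ m ∈ l.toFinset, listBrace x l (update y m (y m * (y j * y i)))
      + ∑ m ∈ l.toFinset, ∑ n ∈ l.toFinset, listBrace x l
        (update (update y m (y m * y i)) n (update y m (y m * y i) n * y j)) =
      ∑ m ∈ l.toFinset, listBrace x l (update y m (y m * (y i * y j)))
      + ∑ m ∈ l.toFinset, ∑ n ∈ l.toFinset, listBrace x l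
        (update (update y m (y m * y j)) n (update y m (y m * y j) n * y i)) := by
    rw [Finset.sum_comm (f := fun m n => listBrace x l
        (update (update y m (y m * y j)) n (update y m (y m * y j) n * y i))),
      ← Finset.sum_add_distrib, ← Finset.sum_add_distrib]
    refine Finset.sum_congr rfl fun m hm => ?_
    -- The diagonal `n = m` needs the pre-Lie identity in slot `m`; off the diagonal the two updates
    -- commute.
    rw [← Finset.add_sum_erase _ _ hm,
      ← Finset.add_sum_erase _ (fun n => listBrace x l (update (update y n (y n * y j)) m
        (update y n (y n * y j) m * y i))) hm, ← add_assoc, ← add_assoc]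
    congr 1
    · simp only [update_self, update_idem]
      have hm' : m ∈ l := List.mem_toFinset.1 hm
      rw [← listBrace_update_add x hnd y hm', ← listBrace_update_add x hnd y hm']
      congr 2
      have := assoc (y m) (y i) (y j)
      rw [sub_eq_sub_iff_add_eq_add] at this
      rw [add_comm, this, add_comm]
    · refine Finset.sum_congr rfl fun n hn => ?_
      have hnm : n ≠ m := Finset.ne_of_mem_erase hn
      rw [update_of_ne hnm, update_of_ne hnm.symm, update_comm hnm]
  rw [add_assoc, add_assoc, main, assoc, add_comm (∑ m ∈ l.toFinset, _ * y i)]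

theorem listBrace_perm [RightPreLieRing L] (x : L) {l l' : List ι} (h : l.Perm l')
    (hl : l.Nodup) (y : ι → L) : listBrace x l y = listBrace x l' y := by
  induction h generalizing y with
  | nil => rfl
  | cons i h ih =>
    simp only [listBrace, ih (List.nodup_cons.1 hl).2, List.toFinset_eq_of_perm _ _ h]
  | swap i j l => exact listBrace_swap x hl y
  | trans h₁ _ ih₁ ih₂ => rw [ih₁ hl, ih₂ (h₁.nodup_iff.1 hl)]

end ListBrace

/-- The symmetric brace `x{y i : i ∈ s}` over a finite set in a right pre-Lie ring. -/
noncomputable def symmBrace {ι L : Type*} [DecidableEq ι] [RightPreLieRing L] (x : L)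
    (s : Finset ι) (y : ι → L) : L :=
  listBrace x s.toList y

section SymmBrace

variable {ι κ L : Type*} [DecidableEq ι] [DecidableEq κ] [RightPreLieRing L]

@[simp]
theorem symmBrace_empty (x : L) (y : ι → L) : symmBrace x ∅ y = x := by
  simp [symmBrace, listBrace]

theorem symmBrace_congr (x : L) (s : Finset ι) {y z : ι → L} (h : ∀ i ∈ s, y i = z i) :
    symmBrace x s y = symmBrace x s z :=
  listBrace_congr x _ fun i hi => h i (Finset.mem_toList.1 hi)

/-- By symmetry any element may play the role of the head of the list, so the recursion no longer
depends on the order chosen by `toList`. -/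
theorem symmBrace_insert (x : L) {s : Finset ι} {i : ι} (hi : i ∉ s) (y : ι → L) :
    symmBrace x (insert i s) y =
      symmBrace x s y * y i - ∑ j ∈ s, symmBrace x s (update y j (y j * y i)) := by
  unfold symmBrace
  rw [listBrace_perm x (Finset.toList_insert hi) (Finset.nodup_toList _), listBrace,
    Finset.toList_toFinset]

theorem symmBrace_map (x : L) (s : Finset ι) (e : ι ↪ κ) (y : κ → L) :
    symmBrace x (s.map e) y = symmBrace x s (y ∘ e) := by
  induction s using Finset.induction_on generalizing y with
  | empty => simp
  | insert i s hi ih =>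
    rw [Finset.map_insert, symmBrace_insert x (by simpa using hi), symmBrace_insert x hi, ih,
      Finset.sum_map]
    congr 1
    refine Finset.sum_congr rfl fun j _ => ?_
    rw [ih, update_comp_eq_of_injective _ e.injective]
    rfl

theorem symmBrace_update_sum {α : Type*} (x : L) (s : Finset ι) (y : ι → L) {i : ι} (hi : i ∈ s)
    (t : Finset α) (u : α → L) :
    symmBrace x s (update y i (∑ a ∈ t, u a)) = ∑ a ∈ t, symmBrace x s (update y i (u a)) :=
  map_sum (AddMonoidHom.mk' (fun v => symmBrace x s (update y i v)) fun v w =>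
    listBrace_update_add x (Finset.nodup_toList s) y (Finset.mem_toList.2 hi) v w) u t

end SymmBrace

/-! ### The value of a tree in a pre-Lie ring -/

namespace ColoredRootedTree

variable {X : Type u} {L : Type v}

/-- The children of a vertex. -/
noncomputable def children (T : ColoredRootedTree X) (a : T.carrier) : Finset T.carrier := by
  classical exact Finset.univ.filter fun c => a ⋖ c

@[simp]
theorem mem_children {T : ColoredRootedTree X} {a c : T.carrier} :
    c ∈ T.children a ↔ a ⋖ c := by
  simp [children]

theorem eq_of_covBy_of_le {T : ColoredRootedTree X} {a b c v : T.carrier} (hb : a ⋖ b)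
    (hc : a ⋖ c) (hbv : b ≤ v) (hcv : c ≤ v) : b = c := by
  rcases T.comparable v b c hbv hcv with h | h
  · exact h.eq_or_lt.resolve_right (hc.2 hb.1)
  · exact (h.eq_or_lt.resolve_right (hb.2 hc.1)).symm

open Classical in
/-- The value of the branch at a vertex under the evaluation of colors by `f`, that is, the
symmetric brace of the color of the vertex with the values of its children. -/
noncomputable def branchValue [RightPreLieRing L] (f : X → L) (T : ColoredRootedTree X) :
    T.carrier → L :=
  WellFoundedGT.fix fun a val =>
    -- The default 0 is never read, since children lie strictly above `a`.
    symmBrace (f (T.color a)) (T.children a) fun c => if h : a < c then val c h else 0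

open Classical in
theorem branchValue_eq [RightPreLieRing L] (f : X → L) (T : ColoredRootedTree X)
    (a : T.carrier) :
    branchValue f T a = symmBrace (f (T.color a)) (T.children a) (branchValue f T) := by
  unfold branchValue
  rw [WellFoundedGT.fix_eq]
  exact symmBrace_congr _ _ fun c hc => dif_pos (mem_children.1 hc).1

theorem branchValue_vertex [RightPreLieRing L] (f : X → L) (x : X) (a : (vertex x).carrier) :
    branchValue f (vertex x) a = f x := by
  classical
  have h : (vertex x).children a = ∅ := by
    ext c
    simp only [mem_children, Finset.notMem_empty, iff_false]
    exact fun h => h.1.ne (Subsingleton.elim (α := Unit) _ _)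
  rw [branchValue_eq, h, symmBrace_empty]
  rfl

/-- The branch value only depends on the branch: it is preserved by an embedding onto an upper
set. -/
theorem branchValue_comp [RightPreLieRing L] (f : X → L) {S T : ColoredRootedTree X}
    (e : S.carrier ↪o T.carrier) (he : ∀ a, T.color (e a) = S.color a) (a : S.carrier)
    (hup : ∀ b, a ≤ b → ∀ t, e b ≤ t → t ∈ Set.range e) :
    branchValue f T (e a) = branchValue f S a := by
  classical
  induction a using WellFoundedGT.induction with
  | ind a ih =>
    have hch : T.children (e a) = (S.children a).map e.toEmbedding := by
      ext t
      simp only [mem_children, Finset.mem_map, RelEmbedding.coe_toEmbedding]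
      constructor
      · intro ht
        obtain ⟨b, rfl⟩ := hup a le_rfl t ht.1.le
        exact ⟨b, ⟨e.lt_iff_lt.1 ht.1, fun c hc hcb =>
          ht.2 (e.lt_iff_lt.2 hc) (e.lt_iff_lt.2 hcb)⟩, rfl⟩
      · rintro ⟨b, hb, rfl⟩
        refine ⟨e.lt_iff_lt.2 hb.1, fun t ht htb => ?_⟩
        obtain ⟨c, rfl⟩ := hup a le_rfl t ht.le
        exact hb.2 (e.lt_iff_lt.1 ht) (e.lt_iff_lt.1 htb)
    rw [branchValue_eq, branchValue_eq, hch, symmBrace_map, he]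
    refine symmBrace_congr _ _ fun c hc => ?_
    have hac := (mem_children.1 hc).1
    exact ih c hac fun b hb => hup b (hac.le.trans hb)

/-- The value of a tree. -/
noncomputable def value [RightPreLieRing L] (f : X → L) (T : ColoredRootedTree X) : L :=
  branchValue f T T.root

theorem Iso.map_root {S T : ColoredRootedTree X} (e : Iso S T) : e.toOrderIso S.root = T.root :=
  le_antisymm (by rw [← e.toOrderIso.le_symm_apply]; exact S.root_le _) (T.root_le _)

theorem Iso.value_eq [RightPreLieRing L] (f : X → L) {S T : ColoredRootedTree X} (e : Iso S T) :
    value f S = value f T := by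
  unfold value
  rw [← e.map_root]
  exact (branchValue_comp f e.toOrderIso.toOrderEmbedding e.color_apply S.root
    fun _ _ t _ => e.toOrderIso.surjective t).symm

section Graft

variable {S T : ColoredRootedTree X} {v : S.carrier}

/-- The inclusion of the first tree in a grafting. -/
def graftInl (S : ColoredRootedTree X) (v : S.carrier) (T : ColoredRootedTree X) :
    S.carrier ↪o (S.graft v T).carrier where
  toFun := Sum.inl
  inj' := Sum.inl_injective
  map_rel_iff' := Iff.rfl

/-- The inclusion of the second tree in a grafting. -/
def graftInr (S : ColoredRootedTree X) (v : S.carrier) (T : ColoredRootedTree X) :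
    T.carrier ↪o (S.graft v T).carrier where
  toFun := Sum.inr
  inj' := Sum.inr_injective
  map_rel_iff' := Iff.rfl

theorem graftInl_le_graftInr {a : S.carrier} {b : T.carrier} :
    graftInl S v T a ≤ graftInr S v T b ↔ a ≤ v := Iff.rfl

theorem not_graftInr_le_graftInl {a : S.carrier} {b : T.carrier} :
    ¬ graftInr S v T b ≤ graftInl S v T a := fun h => h

@[elab_as_elim]
theorem graft_cases {p : (S.graft v T).carrier → Prop} (x : (S.graft v T).carrier)
    (inl : ∀ a, p (graftInl S v T a)) (inr : ∀ b, p (graftInr S v T b)) : p x :=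
  Sum.casesOn x inl inr

theorem graftInl_covBy_graftInl {a b : S.carrier} :
    graftInl S v T a ⋖ graftInl S v T b ↔ a ⋖ b := by
  constructor
  · exact fun h => ⟨(graftInl S v T).lt_iff_lt.1 h.1, fun c hc hcb =>
      h.2 ((graftInl S v T).lt_iff_lt.2 hc) ((graftInl S v T).lt_iff_lt.2 hcb)⟩
  · refine fun h => ⟨(graftInl S v T).lt_iff_lt.2 h.1, fun t hc hcb => ?_⟩
    induction t using graft_cases with
    | inl c => exact h.2 ((graftInl S v T).lt_iff_lt.1 hc) ((graftInl S v T).lt_iff_lt.1 hcb)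
    | inr c => exact not_graftInr_le_graftInl hcb.le

theorem graftInl_covBy_graftInr {a : S.carrier} {b : T.carrier} :
    graftInl S v T a ⋖ graftInr S v T b ↔ a = v ∧ b = T.root := by
  constructor
  · intro h
    have hav : a ≤ v := graftInl_le_graftInr.1 h.1.le
    constructor
    · refine hav.eq_or_lt.resolve_right fun hlt => h.2 ((graftInl S v T).lt_iff_lt.2 hlt) ?_
      exact lt_of_le_not_ge (graftInl_le_graftInr.2 le_rfl) not_graftInr_le_graftInl
    · refine ((T.root_le b).eq_or_lt.resolve_right fun hlt => h.2 ?_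
        ((graftInr S v T).lt_iff_lt.2 hlt)).symm
      exact lt_of_le_not_ge (graftInl_le_graftInr.2 hav) not_graftInr_le_graftInl
  · rintro ⟨rfl, rfl⟩
    refine ⟨lt_of_le_not_ge (graftInl_le_graftInr.2 le_rfl) not_graftInr_le_graftInl,
      fun t hc hcb => ?_⟩
    induction t using graft_cases with
    | inl c => exact ((graftInl S a T).lt_iff_lt.1 hc).not_ge (graftInl_le_graftInr.1 hcb.le)
    | inr c => exact ((graftInr S a T).lt_iff_lt.1 hcb).not_ge (T.root_le c)

theorem branchValue_graftInr [RightPreLieRing L] (f : X → L) (b : T.carrier) :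
    branchValue f (S.graft v T) (graftInr S v T b) = branchValue f T b :=
  branchValue_comp f (graftInr S v T) (fun _ => rfl) b <| by
    intro c _ t h
    induction t using graft_cases with
    | inl d => exact (not_graftInr_le_graftInl h).elim
    | inr d => exact ⟨d, rfl⟩

theorem branchValue_graftInl_of_not_le [RightPreLieRing L] (f : X → L) {a : S.carrier}
    (h : ¬ a ≤ v) : branchValue f (S.graft v T) (graftInl S v T a) = branchValue f S a :=
  branchValue_comp f (graftInl S v T) (fun _ => rfl) a <| by
    intro c hc t hd
    induction t using graft_cases with
    | inl d => exact ⟨d, rfl⟩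
    | inr d => exact (h (hc.trans (graftInl_le_graftInr.1 hd))).elim

open Classical in
-- Grafting adds the root of `T` to the children of `v` and leaves the branches at the old children
-- intact, so this is the brace recursion for one inserted argument.
theorem branchValue_graftInl_self [RightPreLieRing L] (f : X → L) :
    branchValue f (S.graft v T) (graftInl S v T v) = branchValue f S v * value f T -
      ∑ c ∈ S.children v, symmBrace (f (S.color v)) (S.children v)
        (update (branchValue f S) c (branchValue f S c * value f T)) := by
  have hch : (S.graft v T).children (graftInl S v T v) =
      insert (graftInr S v T T.root) ((S.children v).map (graftInl S v T).toEmbedding) := by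
    ext t
    induction t using graft_cases with
    | inl b =>
      have : graftInl S v T b ≠ graftInr S v T T.root := Sum.inl_ne_inr
      simp [graftInl_covBy_graftInl, this]
    | inr b =>
      have : ∀ a, graftInl S v T a ≠ graftInr S v T b := fun _ => Sum.inl_ne_inr
      simp [graftInl_covBy_graftInr, this]
  have hval : ∀ c ∈ S.children v,
      branchValue f (S.graft v T) (graftInl S v T c) = branchValue f S c := fun c hc =>
    branchValue_graftInl_of_not_le f (mem_children.1 hc).1.not_ge
  have hnot : graftInr S v T T.root ∉ (S.children v).map (graftInl S v T).toEmbedding := by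
    simp only [Finset.mem_map, not_exists, not_and]
    exact fun a _ => Sum.inl_ne_inr
  rw [branchValue_eq, hch, symmBrace_insert _ hnot, symmBrace_map, Finset.sum_map,
    branchValue_graftInr, branchValue_eq f S v]
  congr 1
  · congr 1
    exact symmBrace_congr _ _ hval
  · refine Finset.sum_congr rfl fun c hc => ?_
    rw [symmBrace_map, update_comp_eq_of_injective _ (graftInl S v T).toEmbedding.injective]
    refine symmBrace_congr _ _ fun d hd => ?_
    by_cases hdc : d = c
    · subst hdc
      simp only [update_self]
      exact congrArg (· * _) (hval d hd)
    · rw [update_of_ne hdc, update_of_ne hdc]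
      exact hval d hd

open Classical in
-- Below `v`, grafting changes no set of children, and `c` is the only child of `a` whose branch
-- contains `v`.
theorem branchValue_graftInl_of_covBy [RightPreLieRing L] (f : X → L) {a c : S.carrier}
    (hac : a ⋖ c) (hcv : c ≤ v) :
    branchValue f (S.graft v T) (graftInl S v T a) =
      symmBrace (f (S.color a)) (S.children a) (update (branchValue f S) c
        (branchValue f (S.graft v T) (graftInl S v T c))) := by
  have hch : (S.graft v T).children (graftInl S v T a) =
      (S.children a).map (graftInl S v T).toEmbedding := by
    ext t
    induction t using graft_cases with
    | inl b => simp [graftInl_covBy_graftInl]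
    | inr b =>
      have : ∀ a, graftInl S v T a ≠ graftInr S v T b := fun _ => Sum.inl_ne_inr
      simp [graftInl_covBy_graftInr, this, (hac.1.trans_le hcv).ne]
  rw [branchValue_eq, hch, symmBrace_map]
  refine symmBrace_congr _ _ fun d hd => ?_
  by_cases hdc : d = c
  · subst hdc
    simp
  · rw [update_of_ne hdc]
    exact branchValue_graftInl_of_not_le f fun hdv =>
      hdc (eq_of_covBy_of_le (mem_children.1 hd) hac hdv hcv)

open Classical in
theorem sum_branchValue_graft [RightPreLieRing L] (f : X → L) (S T : ColoredRootedTree X)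
    (a : S.carrier) :
    ∑ v with a ≤ v, branchValue f (S.graft v T) (graftInl S v T a) =
      branchValue f S a * value f T := by
  induction a using WellFoundedGT.induction with
  | ind a ih =>
    -- A vertex above `a` is `a` itself or lies above exactly one child of `a`.
    have hsplit : (Finset.univ.filter fun v => a ≤ v) =
        insert a ((S.children a).biUnion fun c => Finset.univ.filter fun v => c ≤ v) := by
      ext v
      simp only [Finset.mem_filter, Finset.mem_univ, true_and, Finset.mem_insert,
        Finset.mem_biUnion, mem_children]
      constructor
      · intro h
        rcases h.eq_or_lt with rfl | h
        · exact Or.inl rfl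
        · exact Or.inr (exists_covBy_le_of_lt h)
      · rintro (rfl | ⟨c, hac, hcv⟩)
        · exact le_rfl
        · exact hac.1.le.trans hcv
    have hnot : a ∉ (S.children a).biUnion fun c => Finset.univ.filter fun v => c ≤ v := by
      simp only [Finset.mem_filter, Finset.mem_univ, true_and, Finset.mem_biUnion, mem_children,
        not_exists, not_and]
      exact fun c hac => hac.1.not_ge
    rw [hsplit, Finset.sum_insert hnot, branchValue_graftInl_self, Finset.sum_biUnion]
    -- The sum over `v` above a child `c` equals, by induction and linearity in slot `c`, the
    -- correction term indexed by `c`.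
    · rw [sub_add_eq_add_sub, sub_eq_iff_eq_add]
      congr 1
      refine Finset.sum_congr rfl fun c hc => ?_
      rw [← ih c (mem_children.1 hc).1, symmBrace_update_sum _ _ _ hc]
      refine Finset.sum_congr rfl fun v hv => ?_
      exact branchValue_graftInl_of_covBy f (mem_children.1 hc) (Finset.mem_filter.1 hv).2
    · intro b hb c hc hbc
      refine Finset.disjoint_left.2 fun v hbv hcv => hbc ?_
      exact eq_of_covBy_of_le (mem_children.1 hb) (mem_children.1 hc)
        (Finset.mem_filter.1 hbv).2 (Finset.mem_filter.1 hcv).2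

theorem sum_value_graft [RightPreLieRing L] (f : X → L) (S T : ColoredRootedTree X) :
    ∑ v, value f (S.graft v T) = value f S * value f T := by
  classical
  have h := sum_branchValue_graft f S T S.root
  rwa [Finset.filter_true_of_mem fun v _ => S.root_le v] at h

end Graft

end ColoredRootedTree

end

/-! ### Iterated graftings and induction on trees -/

namespace ColoredRootedTree

variable {X : Type u}

theorem graft_graft_inr_equiv (S : ColoredRootedTree X) (v : S.carrier)
    (T : ColoredRootedTree X) (w : T.carrier) (U : ColoredRootedTree X) :
    (S.graft v T).graft (graftInr S v T w) U ≈ S.graft v (T.graft w U) :=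
  ⟨{ toOrderIso :=
      { toEquiv := Equiv.sumAssoc _ _ _
        map_rel_iff' := by rintro ((a | a) | a) ((b | b) | b) <;> exact Iff.rfl }
     color_apply := by rintro ((a | a) | a) <;> rfl }⟩

theorem graft_graft_inl_equiv (S : ColoredRootedTree X) (v w : S.carrier)
    (T U : ColoredRootedTree X) :
    (S.graft v T).graft (graftInl S v T w) U ≈ (S.graft w U).graft (graftInl S w U v) T :=
  ⟨{ toOrderIso :=
      { toEquiv := ((Equiv.sumAssoc _ _ _).trans
          (Equiv.sumCongr (Equiv.refl _) (Equiv.sumComm _ _))).trans (Equiv.sumAssoc _ _ _).symm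
        map_rel_iff' := by rintro ((a | a) | a) ((b | b) | b) <;> exact Iff.rfl }
     color_apply := by rintro ((a | a) | a) <;> rfl }⟩

theorem sum_graft_vertices {M : Type*} [AddCommMonoid M] (S T : ColoredRootedTree X)
    (v : S.carrier) (g : (S.graft v T).carrier → M) :
    ∑ w, g w = ∑ a, g (graftInl S v T a) + ∑ b, g (graftInr S v T b) :=
  Fintype.sum_sum_type g

/-- The branch of a tree at a vertex. -/
noncomputable def branch (T : ColoredRootedTree X) (c : T.carrier) : ColoredRootedTree X where
  carrier := {w : T.carrier // c ≤ w}
  fintype := Fintype.ofFinite _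
  root := ⟨c, le_rfl⟩
  root_le v := v.2
  comparable x y z := T.comparable x y z
  color w := T.color w

/-- The complement of the branch of a tree at a vertex other than the root. -/
noncomputable def pruned (T : ColoredRootedTree X) (c : T.carrier) (hc : T.root < c) :
    ColoredRootedTree X where
  carrier := {w : T.carrier // ¬ c ≤ w}
  fintype := Fintype.ofFinite _
  root := ⟨T.root, hc.not_ge⟩
  root_le v := T.root_le v
  comparable x y z := T.comparable x y z
  color w := T.color w

theorem pruned_graft_branch_equiv (T : ColoredRootedTree X) {c : T.carrier}
    (hc : T.root ⋖ c) :
    (T.pruned c hc.1).graft (T.pruned c hc.1).root (T.branch c) ≈ T := by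
  classical
  refine ⟨⟨⟨(Equiv.sumComm _ _).trans (Equiv.sumCompl fun w => c ≤ w), ?_⟩, ?_⟩⟩
  · rintro (⟨a, ha⟩ | ⟨a, ha⟩) (⟨b, hb⟩ | ⟨b, hb⟩)
    · exact Iff.rfl
    · change a ≤ b ↔ a ≤ T.root
      refine ⟨fun hab => ?_, fun h => h.trans (T.root_le b)⟩
      -- A vertex `a` outside the branch but below one of its vertices is comparable to `c`, hence
      -- strictly below `c`; as `c` covers the root, `a` is the root.
      rcases T.comparable b a c hab hb with h | h
      · have hac : a < c := h.lt_of_not_ge ha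
        exact (((T.root_le a).eq_or_lt).resolve_right fun h' => hc.2 h' hac).ge
      · exact (ha h).elim
    · exact ⟨fun h => hb (ha.trans h), False.elim⟩
    · exact Iff.rfl
  · rintro (a | a) <;> rfl

/-- The number of pairs of vertices of a tree such that the first is not below the second. -/
noncomputable def numNotLE (T : ColoredRootedTree X) : ℕ :=
  {p : T.carrier × T.carrier | ¬ p.1 ≤ p.2}.ncard

/-- `g × g` injects the unrelated pairs of `S` into those of `T` and misses `(x, y)`. -/
theorem numNotLE_lt {S T : ColoredRootedTree X} {g : S.carrier → T.carrier}
    (hg : Function.Injective g) (hle : ∀ a b, g a ≤ g b → a ≤ b) {x y : T.carrier}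
    (hxy : ¬ x ≤ y) (hne : ∀ a b, g a = x → g b = y → a ≤ b) : numNotLE S < numNotLE T := by
  unfold numNotLE
  rw [← Set.ncard_image_of_injective _ (hg.prodMap hg)]
  refine Set.ncard_lt_ncard ⟨?_, fun h => ?_⟩ (Set.toFinite _)
  · rintro _ ⟨⟨a, b⟩, hab, rfl⟩
    exact fun h => hab (hle a b h)
  · obtain ⟨⟨a, b⟩, hab, h⟩ := h (show (x, y) ∈ {p : T.carrier × T.carrier | ¬ p.1 ≤ p.2} from hxy)
    exact hab (hne a b (congrArg Prod.fst h) (congrArg Prod.snd h))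

theorem Iso.numNotLE_le {S T : ColoredRootedTree X} (e : Iso S T) : numNotLE S ≤ numNotLE T := by
  unfold numNotLE
  refine Set.ncard_le_ncard_of_injOn (Prod.map e.toOrderIso e.toOrderIso) ?_ ?_ (Set.toFinite _)
  · rintro ⟨a, b⟩ hab h
    exact hab (e.toOrderIso.le_iff_le.1 h)
  · exact (e.toOrderIso.injective.prodMap e.toOrderIso.injective).injOn

theorem equiv_vertex (T : ColoredRootedTree X) (h : ∀ v, v = T.root) :
    vertex (T.color T.root) ≈ T :=
  ⟨{ toOrderIso :=
      { toFun := fun _ => T.root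
        invFun := fun _ => ()
        left_inv := fun _ => rfl
        right_inv := fun v => (h v).symm
        map_rel_iff' := ⟨fun _ => le_refl (α := Unit) (), fun _ => le_rfl⟩ }
     color_apply := fun _ => rfl }⟩

/-- Every tree is obtained from the one-vertex trees by grafting on the root; the grafting on the
root may be assumed to come after the graftings of the same trees on the other vertices. -/
theorem graft_induction {p : ColoredRootedTree X → Prop} (equiv : ∀ S T, S ≈ T → p S → p T)
    (vertex : ∀ x, p (vertex x))
    (graft : ∀ S T, p S → p T → (∀ v, v ≠ S.root → p (S.graft v T)) → p (S.graft S.root T))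
    (T : ColoredRootedTree X) : p T := by
  induction hn : numNotLE T using Nat.strong_induction_on generalizing T with
  | _ n ih =>
    subst hn
    by_cases h : ∀ v, v = T.root
    · exact equiv _ _ (equiv_vertex T h) (vertex _)
    · push Not at h
      obtain ⟨v, hv⟩ := h
      obtain ⟨c, hc, -⟩ := exists_covBy_le_of_lt ((T.root_le v).lt_of_ne hv.symm)
      have e := pruned_graft_branch_equiv T hc
      generalize T.pruned c hc.1 = S at e
      generalize T.branch c = U at e
      have hle : numNotLE (S.graft S.root U) ≤ numNotLE T := e.elim fun e => e.numNotLE_le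
      refine equiv _ _ e (graft S U ?_ ?_ fun v hv => ?_)
      · refine ih _ (lt_of_lt_of_le ?_ hle) S rfl
        exact numNotLE_lt (graftInl S S.root U).injective
          (fun a b => (graftInl S S.root U).le_iff_le.1)
          (not_graftInr_le_graftInl (a := S.root) (b := U.root)) fun a b h => (Sum.inl_ne_inr h).elim
      · refine ih _ (lt_of_lt_of_le ?_ hle) U rfl
        exact numNotLE_lt (graftInr S S.root U).injective
          (fun a b => (graftInr S S.root U).le_iff_le.1)
          (not_graftInr_le_graftInl (a := S.root) (b := U.root)) fun a b _ h => (Sum.inr_ne_inl h).elim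
      · refine ih _ (lt_of_lt_of_le ?_ hle) _ rfl
        -- Moving the grafting from the root up to `v` keeps all relations and adds at least that of
        -- `v` with the root of `U`.
        refine numNotLE_lt (S := S.graft v U) (T := S.graft S.root U) (g := id)
          Function.injective_id ?_ (x := graftInl S S.root U v) (y := graftInr S S.root U U.root)
          (fun h => hv (le_antisymm h (S.root_le v))) ?_
        · rintro (a | a) (b | b) h
          · exact h
          · exact le_trans (α := S.carrier) h (S.root_le v)
          · exact h
          · exact h
        · rintro _ _ rfl rfl
          exact le_refl (α := S.carrier) v

end ColoredRootedTree

/-! ### The pre-Lie identity and the universal property -/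

namespace PL

open ColoredRootedTree

variable {k : Type w} [CommRing k] {X : Type u}

theorem ofTree_congr {S T : ColoredRootedTree X} (h : S ≈ T) : ofTree k S = ofTree k T :=
  congrArg (basis k X) (Quotient.sound h)

@[elab_as_elim]
theorem induction_on {p : PL k X → Prop} (a : PL k X) (ofTree : ∀ T, p (ofTree k T))
    (add : ∀ a b, p a → p b → p (a + b)) (smul : ∀ (r : k) a, p a → p (r • a)) (zero : p 0) :
    p a := by
  refine Submodule.span_induction (p := fun a _ => p a) ?_ zero (fun a b _ _ => add a b)
    (fun r a _ => smul r a) ((basis k X).mem_span a)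
  rintro _ ⟨t, rfl⟩
  exact Quotient.inductionOn t ofTree

/-- In `(S ∘ T) ∘ U`, the terms with `U` grafted on a vertex of `T` are exactly `S ∘ (T ∘ U)`; those
with `U` on a vertex of `S` remain. -/
theorem associator_ofTree (S T U : ColoredRootedTree X) :
    associator (ofTree k S) (ofTree k T) (ofTree k U) =
      ∑ v, ∑ w, ofTree k ((S.graft v T).graft (graftInl S v T w) U) := by
  simp only [associator, ofTree_mul_ofTree, Finset.sum_mul, Finset.mul_sum, sum_graft_vertices,
    Finset.sum_add_distrib]
  rw [Finset.sum_comm (f := fun w v => ofTree k (S.graft v (T.graft w U))), sub_eq_iff_eq_add]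
  congr 1
  exact Finset.sum_congr rfl fun v _ => Finset.sum_congr rfl fun w _ =>
    ofTree_congr (graft_graft_inr_equiv S v T w U)

theorem associator_symm (a b c : PL k X) : associator a b c = associator a c b := by
  have hadd : ∀ x y z w : PL k X, x - y + (z - w) = x + z - (y + w) := fun x y z w => by abel
  induction a using induction_on with
  | zero => simp [associator]
  | add a a' h h' => simpa [associator, add_mul, hadd] using congrArg₂ (· + ·) h h'
  | smul r a h => simpa [associator, smul_mul_assoc, ← smul_sub] using congrArg (r • ·) h
  | ofTree S =>
  induction b using induction_on with
  | zero => simp [associator]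
  | add a a' h h' => simpa [associator, add_mul, mul_add, hadd] using congrArg₂ (· + ·) h h'
  | smul r a h =>
    simpa [associator, smul_mul_assoc, mul_smul_comm, ← smul_sub] using congrArg (r • ·) h
  | ofTree T =>
  induction c using induction_on with
  | zero => simp [associator]
  | add a a' h h' => simpa [associator, add_mul, mul_add, hadd] using congrArg₂ (· + ·) h h'
  | smul r a h =>
    simpa [associator, smul_mul_assoc, mul_smul_comm, ← smul_sub] using congrArg (r • ·) h
  | ofTree U =>
  rw [associator_ofTree, associator_ofTree, Finset.sum_comm]
  exact Finset.sum_congr rfl fun v _ => Finset.sum_congr rfl fun w _ =>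
    ofTree_congr (graft_graft_inl_equiv S w v T U)

/-- Morphisms from `PL k X` are determined by their values on the one-vertex trees. -/
theorem hom_ext {L : Type v} [NonUnitalNonAssocRing L] [Module k L] {φ ψ : PL k X →ₙₐ[k] L}
    (h : ∀ x, φ (ofTree k (vertex x)) = ψ (ofTree k (vertex x))) : φ = ψ := by
  have htree : ∀ T, φ (ofTree k T) = ψ (ofTree k T) := by
    refine graft_induction (fun S T hST hS => ?_) h fun S T hS hT hST => ?_
    · rwa [← ofTree_congr hST]
    · classical
      have hmul : φ (ofTree k S * ofTree k T) = ψ (ofTree k S * ofTree k T) := by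
        rw [map_mul, map_mul, hS, hT]
      -- Both maps agree on the product and on all graftings away from the root, so the remaining
      -- root term can be cancelled out.
      rw [ofTree_mul_ofTree, map_sum, map_sum, ← Finset.add_sum_erase _ _ (Finset.mem_univ S.root),
        ← Finset.add_sum_erase _ (fun v => ψ (ofTree k (S.graft v T))) (Finset.mem_univ S.root),
        Finset.sum_congr rfl fun v hv => hST v (Finset.ne_of_mem_erase hv)] at hmul
      exact add_right_cancel hmul
  ext a
  induction a using induction_on with
  | ofTree T => exact htree T
  | add a b ha hb => rw [map_add, map_add, ha, hb]
  | smul r a ha => rw [map_smul, map_smul, ha]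
  | zero => rw [map_zero, map_zero]

variable (k) in
/-- The linear map from `PL k X` that sends a tree to its value. -/
noncomputable def liftLinear {L : Type v} [RightPreLieRing L] [RightPreLieAlgebra k L]
    (f : X → L) : PL k X →ₗ[k] L :=
  (basis k X).constr k (Quotient.lift (value f) fun _ _ h => h.elim fun e => e.value_eq f)

@[simp]
theorem liftLinear_ofTree {L : Type v} [RightPreLieRing L] [RightPreLieAlgebra k L] (f : X → L)
    (T : ColoredRootedTree X) : liftLinear k f (ofTree k T) = value f T := by
  rw [liftLinear, ofTree, Module.Basis.constr_basis]
  rfl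

variable (k) in
/-- The morphism from `PL k X` that extends a map from `X` to a right pre-Lie algebra. -/
noncomputable def lift {L : Type v} [RightPreLieRing L] [RightPreLieAlgebra k L] (f : X → L) :
    PL k X →ₙₐ[k] L where
  toFun := liftLinear k f
  map_smul' r a := map_smul (liftLinear k f) r a
  map_zero' := map_zero _
  map_add' := map_add _
  map_mul' a b := by
    induction a using induction_on with
    | zero => simp
    | add a a' h h' => simp only [add_mul, map_add, h, h']
    | smul r a h => simp only [smul_mul_assoc, map_smul, h]
    | ofTree S =>
    induction b using induction_on with
    | zero => simp
    | add a a' h h' => simp only [mul_add, map_add, h, h']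
    | smul r a h => simp only [mul_smul_comm, map_smul, h]
    | ofTree T =>
    simp only [ofTree_mul_ofTree, map_sum, liftLinear_ofTree, sum_value_graft]

theorem lift_vertex {L : Type v} [RightPreLieRing L] [RightPreLieAlgebra k L] (f : X → L)
    (x : X) : lift k f (ofTree k (vertex x)) = f x :=
  (liftLinear_ofTree f _).trans (branchValue_vertex f x _)

end PL

/-- `PL k X` with the grafting product is a pre-Lie algebra (its associator is symmetric in the last
two variables), and it is free on `X`: every map from `X` to a pre-Lie algebra `L` extends along
the one-vertex trees to a unique morphism of pre-Lie algebras `PL k X → L`. -/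
theorem proposition3p1 {k : Type*} [CommRing k] (X : Type*) :
    (∀ a b c : PL k X, associator a b c = associator a c b) ∧
    ∀ (L : Type*) [RightPreLieRing L] [RightPreLieAlgebra k L] (f : X → L),
      ∃! φ : PL k X →ₙₐ[k] L, ∀ x : X, φ (PL.ofTree k (ColoredRootedTree.vertex x)) = f x :=
  ⟨PL.associator_symm, fun _ _ _ f => ⟨PL.lift k f, PL.lift_vertex f, fun _ h =>
    PL.hom_ext fun x => (h x).trans (PL.lift_vertex f x).symm⟩⟩
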